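/- **Proposition.** Consider the formulae of linear logic without propositional variables (with $\wp$ for the connective par), $$A ::= 0 \mid 1 \mid A\otimes A \mid A\oplus A \mid {?}A \mid \top \mid \bot \mid A \wp A \mid A \mathbin{\&} A \mid {!}A ,$$ where the first five forms are called positive and the other ones negative, and let $A^\bot$ be the linear negation (De Morgan dual) of $A$. Let $\wp ^0A=\bot$, $\wp ^{n+1}A=(\wp ^nA)\wp A$, $\otimes^0A=1$, $\otimes^{n+1}A=(\otimes^nA)\otimes A$. Sequents are lists of formulae. *LL* is the usual one-sided sequent calculus of linear logic. *LLTN* has the exchange rule, the cut rule, the usual rules for $1,\bot,\top,\wp ,\oplus,\&$, and the rules $$\frac{\Gamma,{?}\Theta,A\qquad \Delta,{?}\Theta,B}{\Gamma,\Delta,{?}\Theta,A\otimes B}\qquad \frac{\Gamma,\wp ^nA}{\Gamma,{?}A}\ (n\in\mathbb N)\qquad \frac{\Gamma,\otimes^nA\ \text{ for all } n\in\mathbb N}{\Gamma,{!}A};$$ its proofs are the (possibly infinitely branching) trees all of whose branches are finite. A *position* is a finite directed tree (a directed graph whose underlying undirected graph is a tree) with edges labelled by positive formulae, in which every vertex is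 a proponent or an opponent and one vertex holds the token. A tree with some negative labels denotes the one obtained by reversing each negatively labelled edge and dualising its label. A *move* is made by the vertex $v$ that holds the token, on one edge between $v$ and another vertex $w$, and gives the token to $w$; vertices keep their signs, copies of a vertex inherit its sign, and what is not mentioned is unchanged (moves are taken up to isomorphism of positions): * if there is an edge from $w$ to $v$, nothing else changes; * if the edge from $v$ to $w$ is labelled $1$ and is the only edge at $v$, then $v$ and this edge are deleted; * if the edge from $v$ to $w$ is labelled $A\oplus B$, its label becomes $A$, or becomes $B$; * if the edge from $v$ to $w$ is labelled ${?}(A^\bot)$, it is replaced, for some $n\in\mathbb N$, with an edge from $w$ to $v$ labelled $\otimes^nA$; * if the edge from $v$ to $w$ is labelled $A\otimes B$, the other neighbours of $v$ are partitioned into sets $\Gamma,\Gamma',\Theta$ (possibly empty), where each $n\in\Theta$ is reached by an edge from $v$ to $n$ with a label of the form ${?}C$; the edge is deleted and $v$ is replaced with two vertices $v_1,v_2$, with new edges from $v_1$ to $w$ labelled $A$ and from $v_2$ to $w$ labelled $B$; the subtrees that hang from $v$ through $\Gamma$ are attached to $v_1$, those through $\Gamma'$ to $v_2$, and one copy of those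 through $\Theta$ to each of $v_1$ and $v_2$. A *play* from $U$ is a finite path of moves starting at $U$. A *strategy* on $U$ is a set of plays from $U$ that contains the empty play, is closed under prefixes, contains with a play that ends in a position where an opponent holds the token all its extensions by one move, and contains with a play all plays from $U$ isomorphic to it (of the same length, with isomorphic positions). It is *winning* if, at the end of each of its maximal plays (those with no proper extension in the strategy), an opponent holds the token. For rooted trees $T,T'$ (finite, directed, with positively labelled edges), put an edge labelled $A$ from the root of $T$ to the root of $T'$, and let the vertices of $T$ be proponents and those of $T'$ opponents. The formula $A$ is *GLLTN-valid* if there is a $T$ such that for all $T'$ and all placements of the token on a vertex of $T$ or of $T'$ there is a winning strategy on the position so obtained. Then GLLTN-validity is complete neither with respect to LL nor with respect to LLTN: it is not the case that each GLLTN-valid formula is provable in LL, and it is not the case that each GLLTN-valid formula is provable in LLTN. Specifically, $\bot\otimes\bot$ is GLLTN-valid, but is provable neither in LL nor in LLTN. -/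

import Mathlib

namespace LinLogic

/-! ### Formulae and sequent calculi -/

/-- Formulae of linear logic without propositional variables. -/
inductive Formula : Type where
  | zero : Formula
  | one : Formula
  | tensor : Formula → Formula → Formula
  | plus : Formula → Formula → Formula
  | whyNot : Formula → Formula
  | top : Formula
  | bot : Formula
  | par : Formula → Formula → Formula
  | amp : Formula → Formula → Formula
  | bang : Formula → Formula

namespace Formula

/-- Linear negation. -/
def dual : Formula → Formula
  | zero => top
  | one => bot
  | tensor A B => par A.dual B.dual
  | plus A B => amp A.dual B.dual
  | whyNot A => bang A.dual
  | top => zero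
  | bot => one
  | par A B => tensor A.dual B.dual
  | amp A B => plus A.dual B.dual
  | bang A => whyNot A.dual

/-- The positive formulae; the other ones are negative. -/
def IsPositive : Formula → Prop
  | zero => True
  | one => True
  | tensor _ _ => True
  | plus _ _ => True
  | whyNot _ => True
  | top => False
  | bot => False
  | par _ _ => False
  | amp _ _ => False
  | bang _ => False

/-- The `n`-fold tensor power: `1` for `n = 0`, then `(A ^ n) ⊗ A`. -/
def tensorPow (A : Formula) : ℕ → Formula
  | 0 => one
  | n + 1 => tensor (tensorPow A n) A

/-- The `n`-fold par power: `⊥` for `n = 0`, then (the `n`-fold power of `A`) par `A`. -/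
def parPow (A : Formula) : ℕ → Formula
  | 0 => bot
  | n + 1 => par (parPow A n) A

theorem dual_isPositive_iff (A : Formula) : A.dual.IsPositive ↔ ¬ A.IsPositive := by
  cases A <;> simp [dual, IsPositive]

end Formula

open Formula

/-- Sequents are (one-sided) lists of formulae. -/
abbrev Sequent := List Formula

/-- Provability in the usual one-sided sequent calculus of linear logic (with identity, cut and
exchange). -/
inductive LLProvable : Sequent → Prop where
  | ax (A : Formula) : LLProvable [A, A.dual]
  | cut (Γ Δ : Sequent) (A : Formula) :
      LLProvable (Γ ++ [A]) → LLProvable (Δ ++ [A.dual]) → LLProvable (Γ ++ Δ)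
  | exchange (Γ Δ : Sequent) (A B : Formula) :
      LLProvable (Γ ++ B :: A :: Δ) → LLProvable (Γ ++ A :: B :: Δ)
  | one : LLProvable [one]
  | bot (Γ : Sequent) : LLProvable Γ → LLProvable (Γ ++ [bot])
  | top (Γ : Sequent) : LLProvable (Γ ++ [top])
  | tensor (Γ Δ : Sequent) (A B : Formula) :
      LLProvable (Γ ++ [A]) → LLProvable (Δ ++ [B]) → LLProvable (Γ ++ Δ ++ [tensor A B])
  | par (Γ : Sequent) (A B : Formula) :
      LLProvable (Γ ++ [A, B]) → LLProvable (Γ ++ [par A B])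
  | plusLeft (Γ : Sequent) (A B : Formula) :
      LLProvable (Γ ++ [A]) → LLProvable (Γ ++ [plus A B])
  | plusRight (Γ : Sequent) (A B : Formula) :
      LLProvable (Γ ++ [B]) → LLProvable (Γ ++ [plus A B])
  | amp (Γ : Sequent) (A B : Formula) :
      LLProvable (Γ ++ [A]) → LLProvable (Γ ++ [B]) → LLProvable (Γ ++ [amp A B])
  | dereliction (Γ : Sequent) (A : Formula) :
      LLProvable (Γ ++ [A]) → LLProvable (Γ ++ [whyNot A])
  | weakening (Γ : Sequent) (A : Formula) :
      LLProvable Γ → LLProvable (Γ ++ [whyNot A])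
  | contraction (Γ : Sequent) (A : Formula) :
      LLProvable (Γ ++ [whyNot A, whyNot A]) → LLProvable (Γ ++ [whyNot A])
  | promotion (Γ : Sequent) (A : Formula) :
      LLProvable (Γ.map whyNot ++ [A]) → LLProvable (Γ.map whyNot ++ [bang A])

/-- Provability in LLTN: the tensor rule shares formulae `?C` between its two premises, and the
exponentials have the rules of an infinitary `⊕` of par powers and an infinitary `&` of tensor
powers. Proofs are well-founded, infinitely branching trees; the cut rule is included. -/
inductive LLTNProvable : Sequent → Prop where
  | cut (Γ Δ : Sequent) (A : Formula) :
      LLTNProvable (Γ ++ [A]) → LLTNProvable (Δ ++ [A.dual]) → LLTNProvable (Γ ++ Δ)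
  | exchange (Γ Δ : Sequent) (A B : Formula) :
      LLTNProvable (Γ ++ B :: A :: Δ) → LLTNProvable (Γ ++ A :: B :: Δ)
  | one : LLTNProvable [one]
  | bot (Γ : Sequent) : LLTNProvable Γ → LLTNProvable (Γ ++ [bot])
  | top (Γ : Sequent) : LLTNProvable (Γ ++ [top])
  | tensor (Γ Δ Θ : Sequent) (A B : Formula) :
      LLTNProvable (Γ ++ Θ.map whyNot ++ [A]) → LLTNProvable (Δ ++ Θ.map whyNot ++ [B]) →
      LLTNProvable (Γ ++ Δ ++ Θ.map whyNot ++ [tensor A B])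
  | par (Γ : Sequent) (A B : Formula) :
      LLTNProvable (Γ ++ [A, B]) → LLTNProvable (Γ ++ [par A B])
  | plusLeft (Γ : Sequent) (A B : Formula) :
      LLTNProvable (Γ ++ [A]) → LLTNProvable (Γ ++ [plus A B])
  | plusRight (Γ : Sequent) (A B : Formula) :
      LLTNProvable (Γ ++ [B]) → LLTNProvable (Γ ++ [plus A B])
  | amp (Γ : Sequent) (A B : Formula) :
      LLTNProvable (Γ ++ [A]) → LLTNProvable (Γ ++ [B]) → LLTNProvable (Γ ++ [amp A B])
  | whyNot (Γ : Sequent) (A : Formula) (n : ℕ) :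
      LLTNProvable (Γ ++ [parPow A n]) → LLTNProvable (Γ ++ [whyNot A])
  | bang (Γ : Sequent) (A : Formula) :
      (∀ n : ℕ, LLTNProvable (Γ ++ [tensorPow A n])) → LLTNProvable (Γ ++ [bang A])

/-! ### Directed graphs with edges labelled by formulae -/

/-- A directed graph with vertices `V` and with edges labelled by formulae: `lab u v = some A`
means that there is an edge from `u` to `v`, labelled with `A`. -/
structure Net (V : Type) where
  lab : V → V → Option Formula

namespace Net

variable {V W : Type}

/-- The underlying undirected graph. -/
def graph (N : Net V) : SimpleGraph V :=
  SimpleGraph.fromRel fun u v => (N.lab u v).isSome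

/-- The net is a (finite) tree: its underlying graph is a tree, without loops or pairs of opposite
edges (which `graph` does not see). -/
structure IsTree (N : Net V) : Prop where
  finite : Finite V
  asymm : ∀ u v, (N.lab u v).isSome → N.lab v u = none
  tree : N.graph.IsTree

/-- All labels are positive. -/
def IsNormal (N : Net V) : Prop :=
  ∀ u v A, N.lab u v = some A → A.IsPositive

open Classical in
/-- Normalisation: every edge with a negative label is reversed, and its label is replaced with
its dual. -/
noncomputable def normalise (N : Net V) : Net V where
  lab u v :=
    if ∃ A, N.lab u v = some A ∧ A.IsPositive then N.lab u v
    else if ∃ A, N.lab v u = some A ∧ ¬ A.IsPositive then (N.lab v u).map Formula.dual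
    else none

/-- Disjoint union. -/
def disjUnion (M : Net V) (N : Net W) : Net (V ⊕ W) where
  lab x y := match x, y with
    | Sum.inl u, Sum.inl v => M.lab u v
    | Sum.inr u, Sum.inr v => N.lab u v
    | _, _ => none

/-- The subgraph induced on a set of vertices. -/
def induce (N : Net V) (S : Set V) : Net S where
  lab u v := N.lab u v

open Classical in
/-- Removal of the edge from `u` to `v`. -/
noncomputable def removeEdge (N : Net V) (u v : V) : Net V where
  lab x y := if x = u ∧ y = v then none else N.lab x y

open Classical in
/-- Addition of an edge from `u` to `v` labelled with `A`. -/
noncomputable def addEdge (N : Net V) (u v : V) (A : Formula) : Net V where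
  lab x y := if x = u ∧ y = v then some A else N.lab x y

/-- For neighbours `v` and `n`: the vertices on the side of `n`, once the edge between `v` and `n`
has been deleted. -/
def side (N : Net V) (v n : V) : Set V :=
  {x | (N.graph.deleteEdges {s(v, n)}).Reachable n x}

/-- The subtree with root `v` that consists of `v` and of everything that hangs from `v` through
the neighbours in `S`. -/
def branch (N : Net V) (v : V) (S : Set V) : Set V :=
  {x | x = v ∨ ∃ n ∈ S, x ∈ N.side v n}

theorem root_mem_branch (N : Net V) (v : V) (S : Set V) : v ∈ N.branch v S := Or.inl rfl

theorem mem_side_self (N : Net V) (v n : V) : n ∈ N.side v n := SimpleGraph.Reachable.refl n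

theorem IsTree.ne_of_lab {N : Net V} (h : N.IsTree) {u v : V} {A : Formula}
    (huv : N.lab u v = some A) : v ≠ u := by
  rintro rfl
  have := h.asymm v v (by simp [huv])
  simp [huv] at this

end Net

/-! ### Positions -/

/-- The two teams. -/
inductive Player : Type where
  | proponent : Player
  | opponent : Player

/-- A net with a sign for each vertex and a distinguished vertex holding the token. -/
structure SignedNet where
  V : Type
  net : Net V
  sign : V → Player
  token : V

/-- Normalisation of the labels. -/
noncomputable def SignedNet.normalise (P : SignedNet) : SignedNet where
  V := P.V
  net := P.net.normalise
  sign := P.sign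
  token := P.token

/-- Existence of an isomorphism, preserving edges, labels, signs and the token. -/
def SignedNet.Iso (P Q : SignedNet) : Prop :=
  ∃ e : P.V ≃ Q.V, (∀ u v, P.net.lab u v = Q.net.lab (e u) (e v)) ∧
    (∀ u, P.sign u = Q.sign (e u)) ∧ e P.token = Q.token

/-- A position: a punctured, directed, signed, normally labelled tree. -/
structure Position extends SignedNet where
  isTree : net.IsTree
  isNormal : net.IsNormal

namespace Position

/-- The player whose turn it is. -/
def active (P : Position) : Player := P.sign P.token

/-! ### Moves

The next definitions give the targets of moves, before normalisation. Signs are inherited. -/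

/-- The underlying net is replaced with `N` on the same vertices, and `w` gets the token. -/
def passTo (P : Position) (N : Net P.V) (w : P.V) : SignedNet where
  V := P.V
  net := N
  sign := P.sign
  token := w

/-- Target of a `1`-move: the active vertex is deleted, and `w` gets the token. -/
def afterOne (P : Position) (w : P.V) (hw : w ≠ P.token) : SignedNet where
  V := {x : P.V | x ≠ P.token}
  net := P.net.induce {x | x ≠ P.token}
  sign x := P.sign x.1
  token := ⟨w, hw⟩

/-- Target of a tensor move along an edge from the active vertex `v` to `w`, labelled with
`A ⊗ B`. It consists of a first copy of `v` (which keeps what hangs through `Γ` and `Θ`), a second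
copy of `v` (which keeps what hangs through `Γ'` and `Θ`), and the side of `w`, with an edge
labelled `A` from the first copy of `v` to `w`, and an edge labelled `B` from the second copy of
`v` to `w`. -/
noncomputable def afterTensor (P : Position) (w : P.V) (A B : Formula) (Γ Γ' Θ : Set P.V) :
    SignedNet where
  V := P.net.branch P.token (Γ ∪ Θ) ⊕ P.net.branch P.token (Γ' ∪ Θ) ⊕ P.net.side P.token w
  net :=
    (((P.net.induce _).disjUnion ((P.net.induce _).disjUnion (P.net.induce _))).addEdge
      (Sum.inl ⟨P.token, P.net.root_mem_branch _ _⟩)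
      (Sum.inr (Sum.inr ⟨w, P.net.mem_side_self _ _⟩)) A).addEdge
      (Sum.inr (Sum.inl ⟨P.token, P.net.root_mem_branch _ _⟩))
      (Sum.inr (Sum.inr ⟨w, P.net.mem_side_self _ _⟩)) B
  sign := Sum.elim (fun x => P.sign x.1) (Sum.elim (fun x => P.sign x.1) (fun x => P.sign x.1))
  token := Sum.inr (Sum.inr ⟨w, P.net.mem_side_self _ _⟩)

/-- `Q` is isomorphic to the normalisation of `N`. -/
def Is (Q : Position) (N : SignedNet) : Prop := Q.toSignedNet.Iso N.normalise

end Position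

/-- The moves of the game, as a relation between positions. -/
inductive Move (P Q : Position) : Prop where
  /-- The active vertex passes the token along an input edge. -/
  | negative (w : P.V) (A : Formula) (h : P.net.lab w P.token = some A)
      (hQ : Q.Is (P.passTo P.net w)) : Move P Q
  /-- The active vertex deletes itself, along its only adjacent edge. -/
  | one (w : P.V) (h : P.net.lab P.token w = some Formula.one)
      (hsole : ∀ x, P.net.graph.Adj P.token x → x = w)
      (hQ : Q.Is (P.afterOne w (P.isTree.ne_of_lab h))) : Move P Q
  /-- The active vertex splits into two vertices. -/
  | tensor (w : P.V) (A B : Formula) (Γ Γ' Θ : Set P.V)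
      (h : P.net.lab P.token w = some (Formula.tensor A B))
      (hcover : Γ ∪ Γ' ∪ Θ = P.net.graph.neighborSet P.token \ {w})
      (hΓΓ' : Disjoint Γ Γ') (hΓΘ : Disjoint Γ Θ) (hΓ'Θ : Disjoint Γ' Θ)
      (hΘ : ∀ n ∈ Θ, ∃ C, P.net.lab P.token n = some (Formula.whyNot C))
      (hQ : Q.Is (P.afterTensor w A B Γ Γ' Θ)) : Move P Q
  | plusLeft (w : P.V) (A B : Formula) (h : P.net.lab P.token w = some (Formula.plus A B))
      (hQ : Q.Is (P.passTo ((P.net.removeEdge P.token w).addEdge P.token w A) w)) : Move P Q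
  | plusRight (w : P.V) (A B : Formula) (h : P.net.lab P.token w = some (Formula.plus A B))
      (hQ : Q.Is (P.passTo ((P.net.removeEdge P.token w).addEdge P.token w B) w)) : Move P Q
  /-- An output edge labelled with `?A^⊥` is replaced with a reverse edge labelled with the
  `n`-fold tensor power of `A`. -/
  | whyNot (w : P.V) (A : Formula) (n : ℕ)
      (h : P.net.lab P.token w = some (Formula.whyNot A.dual))
      (hQ : Q.Is (P.passTo ((P.net.removeEdge P.token w).addEdge w P.token (A.tensorPow n)) w)) :
      Move P Q

/-! ### Plays and strategies -/

/-- `l` is a play from `U`: a finite path of moves, given by the list of its positions after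
`U`. -/
def IsPlay (U : Position) (l : List Position) : Prop := List.IsChain Move (U :: l)

/-- The last position of a play from `U`. -/
def lastPosition (U : Position) (l : List Position) : Position := l.getLastD U

/-- A strategy on `U`: a set of plays from `U` that contains the empty play, is prefix-closed,
welcoming (it accepts all moves by opponents) and stable under isomorphism of plays. -/
structure IsStrategy (U : Position) (S : Set (List Position)) : Prop where
  isPlay : ∀ l ∈ S, IsPlay U l
  nil_mem : [] ∈ S
  prefix_mem : ∀ l ∈ S, ∀ l', l' <+: l → l' ∈ S
  welcoming : ∀ l ∈ S, (lastPosition U l).active = Player.opponent →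
    ∀ Q, Move (lastPosition U l) Q → l ++ [Q] ∈ S
  iso_mem : ∀ l ∈ S, ∀ l', IsPlay U l' →
    List.Forall₂ (fun P Q : Position => P.toSignedNet.Iso Q.toSignedNet) l l' → l' ∈ S

/-- `l` is maximal in `S`: it belongs to `S`, which contains no (proper) extension of it. -/
def IsMaximalIn (S : Set (List Position)) (l : List Position) : Prop :=
  l ∈ S ∧ ∀ l' ∈ S, l <+: l' → l' = l

/-- A winning strategy (for the proponents): in all maximal positions, the token is held by an
opponent. -/
def IsWinning (U : Position) (S : Set (List Position)) : Prop :=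
  IsStrategy U S ∧ ∀ l, IsMaximalIn S l → (lastPosition U l).active = Player.opponent

/-! ### Validity -/

/-- A rooted, directed, normally labelled tree. -/
structure RootedTree where
  V : Type
  net : Net V
  root : V
  isTree : net.IsTree
  isNormal : net.IsNormal

/-- The net obtained from two rooted trees by adding an edge labelled with `A` from the root of
the first one to the root of the second one (before normalisation). -/
noncomputable def joinNet (T T' : RootedTree) (A : Formula) : Net (T.V ⊕ T'.V) :=
  (T.net.disjUnion T'.net).addEdge (Sum.inl T.root) (Sum.inr T'.root) A

theorem Net.normalise_isNormal {V : Type} (N : Net V) : N.normalise.IsNormal := by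
  intro u v A h
  simp only [Net.normalise] at h
  split_ifs at h with h1 h2
  · obtain ⟨B, hB, hp⟩ := h1
    rw [hB] at h
    cases h
    exact hp
  · obtain ⟨B, hB, hp⟩ := h2
    rw [hB] at h
    simp only [Option.map_some, Option.some.injEq] at h
    subst h
    exact (Formula.dual_isPositive_iff B).2 hp

theorem Net.isSome_normalise {V : Type} (N : Net V) (u v : V) : (N.normalise.lab u v).isSome ↔
      (∃ A, N.lab u v = some A ∧ A.IsPositive) ∨ (∃ A, N.lab v u = some A ∧ ¬ A.IsPositive) := by
  simp only [Net.normalise]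
  split_ifs with h1 h2
  · obtain ⟨A, hA, hp⟩ := h1
    simp only [hA, Option.isSome_some, true_iff]
    exact Or.inl ⟨A, rfl, hp⟩
  · obtain ⟨A, hA, hp⟩ := h2
    simp only [hA, Option.map_some, Option.isSome_some, true_iff]
    exact Or.inr ⟨A, rfl, hp⟩
  · simp only [Option.isSome_none, Bool.false_eq_true, false_iff]
    exact fun h3 => h3.elim h1 h2

theorem Net.IsTree.normalise {V : Type} {N : Net V} (h : N.IsTree) : N.normalise.IsTree := by
  have key := N.isSome_normalise
  have hn : ∀ u v A, N.lab u v = some A → N.lab v u = none := fun u v A hA =>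
    h.asymm u v (by simp [hA])
  refine ⟨h.finite, fun u v huv => ?_, ?_⟩
  · by_contra hc
    have h2 : (N.normalise.lab v u).isSome := Option.isSome_iff_ne_none.2 hc
    rw [key] at huv h2
    rcases huv with ⟨A, hA, hp⟩ | ⟨A, hA, hp⟩ <;> rcases h2 with ⟨B, hB, hq⟩ | ⟨B, hB, hq⟩
    · have := hn _ _ _ hA; simp [this] at hB
    · rw [hA] at hB; cases hB; exact hq hp
    · rw [hA] at hB; cases hB; exact hp hq
    · have := hn _ _ _ hA; simp [this] at hB
  · have hg : N.normalise.graph = N.graph := by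
      ext u v
      change u ≠ v ∧ ((N.normalise.lab u v).isSome ∨ (N.normalise.lab v u).isSome) ↔
        u ≠ v ∧ ((N.lab u v).isSome ∨ (N.lab v u).isSome)
      rw [key, key, Option.isSome_iff_exists, Option.isSome_iff_exists]
      have e1 := fun A : Formula => Classical.em A.IsPositive
      constructor
      · rintro ⟨hne, (⟨A, hA, -⟩ | ⟨A, hA, -⟩) | (⟨A, hA, -⟩ | ⟨A, hA, -⟩)⟩
        exacts [⟨hne, Or.inl ⟨A, hA⟩⟩, ⟨hne, Or.inr ⟨A, hA⟩⟩, ⟨hne, Or.inr ⟨A, hA⟩⟩,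
          ⟨hne, Or.inl ⟨A, hA⟩⟩]
      · rintro ⟨hne, ⟨A, hA⟩ | ⟨A, hA⟩⟩ <;> rcases e1 A with hp | hp
        exacts [⟨hne, Or.inl (Or.inl ⟨A, hA, hp⟩)⟩, ⟨hne, Or.inr (Or.inr ⟨A, hA, hp⟩)⟩,
          ⟨hne, Or.inr (Or.inl ⟨A, hA, hp⟩)⟩, ⟨hne, Or.inl (Or.inr ⟨A, hA, hp⟩)⟩]
    rw [hg]
    exact h.tree

theorem isAcyclic_sum {V W : Type} {G : SimpleGraph V} {H : SimpleGraph W} (hG : G.IsAcyclic)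
    (hH : H.IsAcyclic) : (G ⊕g H).IsAcyclic := by
  rw [SimpleGraph.isAcyclic_iff_forall_adj_isBridge] at *
  have hl : ∀ (v v' : V) (x y : V ⊕ W),
      ((G ⊕g H).deleteEdges {s(Sum.inl v, Sum.inl v')}).Reachable x y →
      ∀ a, x = Sum.inl a → ∃ b, y = Sum.inl b ∧ (G.deleteEdges {s(v, v')}).Reachable a b := by
    rintro v v' x y ⟨p⟩
    induction p with
    | nil => intro a ha; exact ⟨a, ha, SimpleGraph.Reachable.refl _⟩
    | @cons x z y hxz p ih =>
      rintro a rfl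
      rcases z with z | z
      · obtain ⟨b, hb, hr⟩ := ih z rfl
        refine ⟨b, hb, SimpleGraph.Reachable.trans (SimpleGraph.Adj.reachable ?_) hr⟩
        simpa [SimpleGraph.deleteEdges_adj] using hxz
      · simp [SimpleGraph.deleteEdges_adj] at hxz
  have hr : ∀ (v v' : W) (x y : V ⊕ W),
      ((G ⊕g H).deleteEdges {s(Sum.inr v, Sum.inr v')}).Reachable x y →
      ∀ a, x = Sum.inr a → ∃ b, y = Sum.inr b ∧ (H.deleteEdges {s(v, v')}).Reachable a b := by
    rintro v v' x y ⟨p⟩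
    induction p with
    | nil => intro a ha; exact ⟨a, ha, SimpleGraph.Reachable.refl _⟩
    | @cons x z y hxz p ih =>
      rintro a rfl
      rcases z with z | z
      · simp [SimpleGraph.deleteEdges_adj] at hxz
      · obtain ⟨b, hb, hr⟩ := ih z rfl
        refine ⟨b, hb, SimpleGraph.Reachable.trans (SimpleGraph.Adj.reachable ?_) hr⟩
        simpa [SimpleGraph.deleteEdges_adj] using hxz
  rintro (v | v) (v' | v') hadj
  · rw [SimpleGraph.isBridge_iff]
    intro hreach
    obtain ⟨b, hb, hr'⟩ := hl v v' _ _ hreach v rfl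
    cases hb
    exact SimpleGraph.isBridge_iff.1 (hG (by simpa using hadj)) hr'
  · simp at hadj
  · simp at hadj
  · rw [SimpleGraph.isBridge_iff]
    intro hreach
    obtain ⟨b, hb, hr'⟩ := hr v v' _ _ hreach v rfl
    cases hb
    exact SimpleGraph.isBridge_iff.1 (hH (by simpa using hadj)) hr'

theorem joinNet_isTree (T T' : RootedTree) (A : Formula) : (joinNet T T' A).IsTree := by
  have hf := T.isTree.finite
  have hf' := T'.isTree.finite
  have hg : (joinNet T T' A).graph =
      (T.net.graph ⊕g T'.net.graph) ⊔ SimpleGraph.edge (Sum.inl T.root) (Sum.inr T'.root) := by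
    ext x y
    rcases x with x | x <;> rcases y with y | y
    · simp [joinNet, Net.graph, Net.addEdge, Net.disjUnion, SimpleGraph.edge_adj]
    · by_cases hxy : x = T.root ∧ y = T'.root <;>
        simp [joinNet, Net.graph, Net.addEdge, Net.disjUnion, SimpleGraph.edge_adj, hxy]
    · by_cases hxy : y = T.root ∧ x = T'.root
      · simp [joinNet, Net.graph, Net.addEdge, Net.disjUnion, SimpleGraph.edge_adj, hxy]
      · have hxy' : ¬ (x = T'.root ∧ y = T.root) := fun h => hxy h.symm
        simp [joinNet, Net.graph, Net.addEdge, Net.disjUnion, SimpleGraph.edge_adj, hxy, hxy']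
    · simp [joinNet, Net.graph, Net.addEdge, Net.disjUnion, SimpleGraph.edge_adj]
  refine ⟨inferInstance, ?_, ?_⟩
  · rintro (x | x) (y | y) h
    · have := T.isTree.asymm x y
      simp_all [joinNet, Net.addEdge, Net.disjUnion]
    · simp [joinNet, Net.addEdge, Net.disjUnion]
    · simp [joinNet, Net.addEdge, Net.disjUnion] at h
    · have := T'.isTree.asymm x y
      simp_all [joinNet, Net.addEdge, Net.disjUnion]
  · rw [hg]
    refine ⟨T.isTree.tree.connected.sum_sup_edge T'.isTree.tree.connected, ?_⟩
    exact (isAcyclic_sum T.isTree.tree.isAcyclic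
      T'.isTree.tree.isAcyclic).sup_edge_of_not_reachable
      (SimpleGraph.not_reachable_sum_inl_inr _ _)

/-- The position in which the proponents are the vertices of `T`, the opponents are those of `T'`,
an edge labelled with `A` goes from the root of `T` to the root of `T'`, and `t` holds the
token. -/
noncomputable def initialPosition (T T' : RootedTree) (A : Formula) (t : T.V ⊕ T'.V) :
    Position where
  V := T.V ⊕ T'.V
  net := (joinNet T T' A).normalise
  sign := Sum.elim (fun _ => Player.proponent) (fun _ => Player.opponent)
  token := t
  isTree := (joinNet_isTree T T' A).normalise
  isNormal := Net.normalise_isNormal _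

/-- GLLTN-validity of a formula: for some tree `T` and all trees `T'`, the vertices of `T` have a
winning strategy against those of `T'`, wherever the token is placed initially. -/
def GLLTNValid (A : Formula) : Prop :=
  ∃ T : RootedTree, ∀ T' : RootedTree, ∀ t : T.V ⊕ T'.V,
    ∃ S : Set (List Position), IsWinning (initialPosition T T' A t) S

end LinLogic

namespace LinLogic

open Formula

/-! ### Classical soundness of the sequent calculi -/

/-! Both calculi are sound for the classical two-valued reading that identifies the multiplicatives
with the additives and erases the exponentials (`LLProvable.truth`, `LLTNProvable.truth`). Under it
`⊥ ⊗ ⊥` is false, hence unprovable.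

For validity, a single proponent vertex suffices. When it gets the token it splits into two leaves
attached to the same opponent `w`, and after normalisation `w` has an edge labelled `1` to each of
them. An opponent can use an edge labelled `1` only if it has no other edge. In a tree with two
proponents, all of them leaves next to opponents, an edge from an opponent to a proponent is never
in that situation. So the token returns to a proponent only along an edge still labelled `⊥ ⊗ ⊥`, on
which that proponent can move.

The invariant `SignedNet.Guarded` records this. All moves preserve it (`Position.guarded_of_move`),
the critical cases being the `1`-move (`guarded_afterOne`) and the two tensor cases. Under it a
proponent with the token always has a move (`Position.exists_move`), so the set of all plays is a
winning strategy. Infinite plays cost nothing, since only maximal plays in the strategy, which are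
finite, are judged. -/

/-- The classical truth value of a formula. -/
def Formula.Truth : Formula → Prop
  | zero => False
  | one => True
  | tensor A B => A.Truth ∧ B.Truth
  | plus A B => A.Truth ∨ B.Truth
  | whyNot A => A.Truth
  | top => True
  | bot => False
  | par A B => A.Truth ∨ B.Truth
  | amp A B => A.Truth ∧ B.Truth
  | bang A => A.Truth

theorem Formula.truth_dual (A : Formula) : A.dual.Truth ↔ ¬ A.Truth := by
  induction A <;> simp_all [dual, Truth] <;> tauto

/-- A par power is an iterated disjunction that starts from a false formula; this makes the `?` rule
of LLTN sound for every `n`. -/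
theorem Formula.truth_of_truth_parPow (A : Formula) (n : ℕ) (h : (A.parPow n).Truth) :
    A.Truth := by
  induction n with
  | zero => exact h.elim
  | succ n ih => exact h.elim ih id

/-- A sequent is classically true if one of its formulae is. -/
def Sequent.Truth (Γ : Sequent) : Prop := ∃ A, A ∈ Γ ∧ A.Truth

theorem Sequent.truth_append (Γ Δ : Sequent) :
    Sequent.Truth (Γ ++ Δ) ↔ Sequent.Truth Γ ∨ Sequent.Truth Δ := by
  simp [Sequent.Truth, or_and_right, exists_or]

theorem Sequent.truth_cons (A : Formula) (Γ : Sequent) :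
    Sequent.Truth (A :: Γ) ↔ A.Truth ∨ Sequent.Truth Γ := by
  simp [Sequent.Truth]

theorem Sequent.not_truth_nil : ¬ Sequent.Truth [] := by
  simp [Sequent.Truth]

theorem LLProvable.truth {Γ : Sequent} (h : LLProvable Γ) : Sequent.Truth Γ := by
  induction h <;>
    simp only [Sequent.truth_append, Sequent.truth_cons, Sequent.not_truth_nil, truth_dual,
      Formula.Truth] at * <;> tauto

theorem LLTNProvable.truth {Γ : Sequent} (h : LLTNProvable Γ) : Sequent.Truth Γ := by
  induction h with
  | whyNot Γ A n _ ih =>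
    have := A.truth_of_truth_parPow n
    simp only [Sequent.truth_append, Sequent.truth_cons, Sequent.not_truth_nil,
      Formula.Truth] at *
    tauto
  | bang Γ A _ ih =>
    -- The premise for `n = 1` is about `1 ⊗ A`, which has the truth value of `A`; the one for `n =
    -- 0` would say nothing.
    have := ih 1
    simp only [Sequent.truth_append, Sequent.truth_cons, Sequent.not_truth_nil, tensorPow,
      Formula.Truth] at *
    tauto
  | _ =>
    simp only [Sequent.truth_append, Sequent.truth_cons, Sequent.not_truth_nil, truth_dual,
      Formula.Truth] at *
    tauto

theorem not_truth_bot_tensor_bot : ¬ Sequent.Truth [tensor bot bot] := by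
  simp [Sequent.Truth, Formula.Truth]

/-! ### Nets -/

namespace Net

variable {V W : Type}

theorem graph_adj (N : Net V) (u v : V) :
    N.graph.Adj u v ↔ u ≠ v ∧ ((N.lab u v).isSome ∨ (N.lab v u).isSome) := Iff.rfl

theorem IsTree.adj_of_lab {N : Net V} (h : N.IsTree) {u v : V} {A : Formula}
    (huv : N.lab u v = some A) : N.graph.Adj u v :=
  ⟨(h.ne_of_lab huv).symm, Or.inl (by simp [huv])⟩

theorem IsTree.lab_eq_none {N : Net V} (h : N.IsTree) {u v : V} {A : Formula}
    (huv : N.lab u v = some A) : N.lab v u = none :=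
  h.asymm u v (by simp [huv])

theorem normalise_lab_of_isPositive {N : Net V} {u v : V} {A : Formula}
    (h : N.lab u v = some A) (hA : A.IsPositive) : N.normalise.lab u v = some A := by
  simp [normalise, h, hA]

theorem normalise_lab_of_not_isPositive {N : Net V} {u v : V} {A : Formula}
    (h : N.lab u v = some A) (hA : ¬ A.IsPositive) (hvu : N.lab v u = none) :
    N.normalise.lab v u = some A.dual := by
  simp [normalise, h, hA, hvu]

theorem isSome_of_isSome_normalise {N : Net V} {u v : V}
    (h : (N.normalise.lab u v).isSome) : (N.lab u v).isSome ∨ (N.lab v u).isSome := by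
  rcases (N.isSome_normalise u v).1 h with ⟨A, hA, -⟩ | ⟨A, hA, -⟩
  · exact Or.inl (by simp [hA])
  · exact Or.inr (by simp [hA])

/-- A set of vertices of a tree that is not empty and is closed under adjacency is everything. -/
theorem IsTree.induction {N : Net V} (h : N.IsTree) {p : V → Prop} {v : V} (hv : p v)
    (hp : ∀ x y, N.graph.Adj x y → p x → p y) (u : V) : p u := by
  obtain ⟨q⟩ := h.tree.connected.preconnected v u
  induction q with
  | nil => exact hv
  | cons hadj _ ih => exact ih (hp _ _ hadj hv)

/-- Only the edge between `v` and `n` is cut, so a step from `x ≠ v` can leave the side only by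
going from `n` to `v`. -/
theorem mem_side_of_adj {N : Net V} {v n x y : V} (hx : x ∈ N.side v n) (hxy : N.graph.Adj x y)
    (hxv : x ≠ v) (h : y ≠ v ∨ x ≠ n) : y ∈ N.side v n := by
  refine SimpleGraph.Reachable.trans hx (SimpleGraph.Adj.reachable ?_)
  rw [SimpleGraph.deleteEdges_adj]
  refine ⟨hxy, ?_⟩
  simp only [Set.mem_singleton_iff, Sym2.eq_iff, not_or, not_and]
  exact ⟨fun h1 => absurd h1 hxv, fun h1 h2 => h.elim (fun h => h h2) (fun h => h h1)⟩

theorem mem_branch_of_adj {N : Net V} {v x y : V} {S : Set V} (hx : x ∈ N.branch v S)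
    (hxy : N.graph.Adj x y) (hxv : x ≠ v) : y ∈ N.branch v S := by
  rcases hx with rfl | ⟨n, hn, hx⟩
  · exact absurd rfl hxv
  · by_cases hy : y = v
    · exact Or.inl hy
    · exact Or.inr ⟨n, hn, mem_side_of_adj hx hxy hxv (Or.inl hy)⟩

/-- Guarantees that no other vertex is lost when `v` splits in a tensor move. -/
theorem IsTree.exists_mem_side {N : Net V} (h : N.IsTree) {v u : V} (hu : u ≠ v) :
    ∃ n, N.graph.Adj v n ∧ u ∈ N.side v n := by
  refine (h.induction (p := fun u => u = v ∨ ∃ n, N.graph.Adj v n ∧ u ∈ N.side v n)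
    (v := v) (Or.inl rfl) ?_ u).resolve_left hu
  intro x y hxy hx
  by_cases hy : y = v
  · exact Or.inl hy
  by_cases hxv : x = v
  · subst hxv
    exact Or.inr ⟨y, hxy, N.mem_side_self _ _⟩
  · obtain ⟨n, hn, hx⟩ := hx.resolve_left hxv
    exact Or.inr ⟨n, hn, mem_side_of_adj hx hxy hxv (Or.inl hy)⟩

/-- Every edge of an acyclic graph is a bridge. -/
theorem IsTree.notMem_side {N : Net V} (h : N.IsTree) {v n : V} (hvn : N.graph.Adj v n) :
    v ∉ N.side v n := fun hv =>
  SimpleGraph.isBridge_iff.1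
    (SimpleGraph.isAcyclic_iff_forall_adj_isBridge.1 h.tree.isAcyclic hvn) hv.symm

theorem branch_empty (N : Net V) (v : V) : N.branch v (∅ ∪ ∅) = {v} := by
  ext x
  simp [branch]

/-- Being a tree does not depend on the labels. -/
theorem IsTree.of_isSome_iff {M N : Net V} (hM : M.IsTree)
    (h : ∀ u v, (N.lab u v).isSome ↔ (M.lab u v).isSome) : N.IsTree := by
  refine ⟨hM.finite, fun u v huv => ?_, ?_⟩
  · have h1 := hM.asymm u v ((h u v).1 huv)
    have h2 := h v u
    rw [h1] at h2
    simpa using h2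
  · have : N.graph = M.graph := by
      ext u v
      rw [graph_adj, graph_adj, h, h]
    rw [this]
    exact hM.tree

/-- The net in which all labels are replaced with `1`. -/
def relabel (N : Net V) : Net V where
  lab u v := (N.lab u v).map fun _ => one

theorem relabel_isNormal (N : Net V) : N.relabel.IsNormal := by
  intro u v A h
  simp only [relabel, Option.map_eq_some_iff] at h
  obtain ⟨_, -, rfl⟩ := h
  trivial

theorem IsTree.relabel {N : Net V} (h : N.IsTree) : N.relabel.IsTree :=
  h.of_isSome_iff fun u v => by simp [Net.relabel]

theorem IsTree.disjUnion_addEdge {M : Net V} {N : Net W} (hM : M.IsTree) (hN : N.IsTree)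
    (a : V) (b : W) (A : Formula) :
    ((M.disjUnion N).addEdge (Sum.inl a) (Sum.inr b) A).IsTree := by
  -- A `RootedTree` must have positive labels; replacing all labels with `1` ensures this without
  -- affecting the tree property.
  refine (joinNet_isTree ⟨V, M.relabel, a, hM.relabel, M.relabel_isNormal⟩
    ⟨W, N.relabel, b, hN.relabel, N.relabel_isNormal⟩ A).of_isSome_iff ?_
  rintro (x | x) (y | y) <;> simp [joinNet, addEdge, disjUnion, Net.relabel]

theorem isTree_of_unique [Unique V] {N : Net V} (h : ∀ u v, N.lab u v = none) : N.IsTree := by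
  refine ⟨inferInstance, fun u v _ => h v u, ?_⟩
  exact SimpleGraph.IsTree.of_subsingleton

theorem IsTree.induce_branch_empty {N : Net V} (h : N.IsTree) (v : V) :
    (N.induce (N.branch v (∅ ∪ ∅))).IsTree := by
  rw [branch_empty]
  refine isTree_of_unique ?_
  rintro ⟨u, rfl⟩ ⟨v, rfl⟩
  by_contra hc
  have hs := Option.isSome_iff_ne_none.2 hc
  exact hc (h.asymm _ _ hs)

theorem IsTree.induce_side {N : Net V} (h : N.IsTree) (v w : V) :
    (N.induce (N.side v w)).IsTree := by
  have hf := h.finite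
  have hg : (N.induce (N.side v w)).graph = N.graph.induce (N.side v w) := by
    ext x y
    simp [graph_adj, induce, Subtype.ext_iff]
  refine ⟨inferInstanceAs (Finite (N.side v w)), fun x y => h.asymm x y, ?_⟩
  rw [hg]
  refine ⟨?_, h.tree.isAcyclic.induce _⟩
  -- A walk that avoids the cut edge never leaves the side, so it survives in the induced graph.
  have key : ∀ (x y : V) (q : (N.graph.deleteEdges {s(v, w)}).Walk x y) (hx : x ∈ N.side v w)
      (hy : y ∈ N.side v w), (N.graph.induce (N.side v w)).Reachable ⟨x, hx⟩ ⟨y, hy⟩ := by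
    intro x y q
    induction q with
    | nil => intro hx hy; exact SimpleGraph.Reachable.refl _
    | @cons x z y hxz q ih =>
      intro hx hy
      have hz : z ∈ N.side v w := SimpleGraph.Reachable.trans hx hxz.reachable
      refine SimpleGraph.Reachable.trans (SimpleGraph.Adj.reachable ?_) (ih hz hy)
      exact (SimpleGraph.deleteEdges_adj.1 hxz).1
  refine (SimpleGraph.connected_iff_exists_forall_reachable _).2 ⟨⟨w, N.mem_side_self _ _⟩, ?_⟩
  rintro ⟨x, hx⟩
  obtain ⟨q⟩ := id hx
  exact key _ _ q _ _

end Net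

/-! ### The invariant of the plays -/

/-- `x` is an opponent and the only neighbour of `u`, and the edge between them is labelled with
`⊥ ⊗ ⊥` or `⊥` (from `u`) or with `1` (from `x`). -/
structure SignedNet.IsLeaf (N : SignedNet) (u x : N.V) : Prop where
  sign : N.sign x = Player.opponent
  sole : ∀ y, (N.net.lab u y).isSome ∨ (N.net.lab y u).isSome → y = x
  lab : N.net.lab u x = some (tensor bot bot) ∨ N.net.lab x u = some one ∨
    (N.net.lab u x = some bot ∧ N.net.lab x u = none)

/-- All proponents are leaves, there are two of them or one with an edge labelled with `⊥ ⊗ ⊥`,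
and a proponent holding the token has an edge labelled with `⊥ ⊗ ⊥`. -/
structure SignedNet.Guarded (N : SignedNet) : Prop where
  leaf : ∀ u, N.sign u = Player.proponent → ∃ x, N.IsLeaf u x
  many : (∃ u x, N.sign u = Player.proponent ∧ N.net.lab u x = some (tensor bot bot)) ∨
    ∃ u u', N.sign u = Player.proponent ∧ N.sign u' = Player.proponent ∧ u ≠ u'
  active : N.sign N.token = Player.proponent →
    ∃ x, N.net.lab N.token x = some (tensor bot bot)

namespace SignedNet

theorem Guarded.normalise {N : SignedNet} (h : N.Guarded) : N.normalise.Guarded := by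
  refine ⟨fun u hu => ?_, ?_, fun ht => ?_⟩
  · obtain ⟨x, hx⟩ := h.leaf u hu
    refine ⟨x, hx.sign, fun y hy => hx.sole y ?_, ?_⟩
    · rcases hy with hy | hy
      · exact Net.isSome_of_isSome_normalise hy
      · exact (Net.isSome_of_isSome_normalise hy).symm
    · rcases hx.lab with hl | hl | ⟨hl, hl'⟩
      · exact Or.inl (Net.normalise_lab_of_isPositive hl trivial)
      · exact Or.inr (Or.inl (Net.normalise_lab_of_isPositive hl trivial))
      -- The `⊥` alternative occurs only before normalisation, which turns it into the `1`
      -- alternative.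
      · exact Or.inr (Or.inl (Net.normalise_lab_of_not_isPositive hl id hl'))
  · rcases h.many with ⟨u, x, hu, hx⟩ | h
    · exact Or.inl ⟨u, x, hu, Net.normalise_lab_of_isPositive hx trivial⟩
    · exact Or.inr h
  · obtain ⟨x, hx⟩ := h.active ht
    exact ⟨x, Net.normalise_lab_of_isPositive hx trivial⟩

theorem Iso.guarded {P Q : SignedNet} (h : P.Iso Q) (hQ : Q.Guarded) : P.Guarded := by
  obtain ⟨e, hl, hs, ht⟩ := h
  refine ⟨fun u hu => ?_, ?_, fun hp => ?_⟩
  · obtain ⟨x, hx⟩ := hQ.leaf (e u) (by rw [← hs, hu])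
    obtain ⟨x, rfl⟩ := e.surjective x
    refine ⟨x, by rw [hs, hx.sign], fun y hy => e.injective (hx.sole _ ?_), ?_⟩
    · rwa [← hl, ← hl]
    · rw [hl, hl]
      exact hx.lab
  · rcases hQ.many with ⟨u, x, hu, hx⟩ | ⟨u, u', hu, hu', hne⟩
    · refine Or.inl ⟨e.symm u, e.symm x, ?_, ?_⟩
      · rw [hs, e.apply_symm_apply, hu]
      · rw [hl, e.apply_symm_apply, e.apply_symm_apply, hx]
    · refine Or.inr ⟨e.symm u, e.symm u', ?_, ?_, fun h => hne (e.symm.injective h)⟩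
      · rw [hs, e.apply_symm_apply, hu]
      · rw [hs, e.apply_symm_apply, hu']
  · obtain ⟨x, hx⟩ := hQ.active (by rw [← ht, ← hs, hp])
    refine ⟨e.symm x, ?_⟩
    rw [hl, ht, e.apply_symm_apply, hx]

end SignedNet

/-! ### Preservation of the invariant by moves -/

namespace Position

theorem ne_of_sign {P : Position} {u v : P.V} (hu : P.sign u = Player.proponent)
    (hv : P.sign v = Player.opponent) : u ≠ v := by
  rintro rfl
  rw [hu] at hv
  cases hv

theorem sign_eq_opponent {N : SignedNet} {u : N.V} (hu : N.sign u ≠ Player.proponent) :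
    N.sign u = Player.opponent := by
  cases h : N.sign u
  · exact absurd h hu
  · rfl

theorem adj_of_isLeaf {P : Position} {u x : P.V} (h : P.IsLeaf u x) : P.net.graph.Adj u x := by
  rcases h.lab with h | h | ⟨h, -⟩
  · exact P.isTree.adj_of_lab h
  · exact (P.isTree.adj_of_lab h).symm
  · exact P.isTree.adj_of_lab h

/-- An output edge of a proponent is labelled with `⊥ ⊗ ⊥`. -/
theorem lab_of_proponent {P : Position} (hP : P.Guarded) {u w : P.V} {A : Formula}
    (hu : P.sign u = Player.proponent) (h : P.net.lab u w = some A) :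
    A = tensor bot bot ∧ P.IsLeaf u w := by
  obtain ⟨x, hx⟩ := hP.leaf u hu
  obtain rfl := hx.sole w (Or.inl (by simp [h]))
  refine ⟨?_, hx⟩
  rcases hx.lab with hl | hl | ⟨hl, -⟩
  · rw [h] at hl
    exact Option.some.inj hl
  · rw [P.isTree.lab_eq_none h] at hl
    cases hl
  · exact (P.isNormal _ _ _ hl).elim

/-- An input edge of a proponent is labelled with `1`. -/
theorem lab_to_proponent {P : Position} (hP : P.Guarded) {u w : P.V} {A : Formula}
    (hu : P.sign u = Player.proponent) (h : P.net.lab w u = some A) :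
    A = one ∧ P.IsLeaf u w := by
  obtain ⟨x, hx⟩ := hP.leaf u hu
  obtain rfl := hx.sole w (Or.inr (by simp [h]))
  refine ⟨?_, hx⟩
  rcases hx.lab with hl | hl | ⟨hl, -⟩
  · rw [P.isTree.lab_eq_none hl] at h
    cases h
  · rw [h] at hl
    exact Option.some.inj hl
  · exact (P.isNormal _ _ _ hl).elim

/-- With `sign_of_lab_to`, this shows that an edge labelled neither `1` nor `⊥ ⊗ ⊥` joins two
opponents, so `⊕`- and `?`-moves change no edge at a proponent. -/
theorem sign_of_lab_from {P : Position} (hP : P.Guarded) {v w : P.V} {A : Formula}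
    (h : P.net.lab v w = some A) (hA : A ≠ one) : P.sign w = Player.opponent :=
  sign_eq_opponent fun hw => hA (lab_to_proponent hP hw h).1

theorem sign_of_lab_to {P : Position} (hP : P.Guarded) {v w : P.V} {A : Formula}
    (h : P.net.lab v w = some A) (hA : A ≠ tensor bot bot) : P.sign v = Player.opponent :=
  sign_eq_opponent fun hv => hA (lab_of_proponent hP hv h).1

/-- Moves that change only edges between opponents. -/
theorem guarded_passTo {P : Position} (hP : P.Guarded) (N : Net P.V) (w : P.V)
    (hN : ∀ u y, P.sign u = Player.proponent →
      N.lab u y = P.net.lab u y ∧ N.lab y u = P.net.lab y u)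
    (hw : P.sign w = Player.proponent → ∃ x, P.net.lab w x = some (tensor bot bot)) :
    (P.passTo N w).Guarded := by
  refine ⟨fun u hu => ?_, ?_, fun ht => ?_⟩
  · obtain ⟨x, hx⟩ := hP.leaf u hu
    refine ⟨x, hx.sign, fun y hy => hx.sole y ?_, ?_⟩
    · rwa [← (hN u y hu).1, ← (hN u y hu).2]
    · rw [show (P.passTo N w).net = N from rfl, (hN u x hu).1, (hN u x hu).2]
      exact hx.lab
  · rcases hP.many with ⟨u, x, hu, hx⟩ | h
    · exact Or.inl ⟨u, x, hu, ((hN u x hu).1).trans hx⟩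
    · exact Or.inr h
  · obtain ⟨x, hx⟩ := hw ht
    exact ⟨x, ((hN w x ht).1).trans hx⟩

theorem guarded_replace_out {P : Position} (hP : P.Guarded) {w : P.V} {A : Formula} (B : Formula)
    (h : P.net.lab P.token w = some A) (h1 : A ≠ one) (h2 : A ≠ tensor bot bot) :
    (P.passTo ((P.net.removeEdge P.token w).addEdge P.token w B) w).Guarded := by
  have hv := sign_of_lab_to hP h h2
  have hw := sign_of_lab_from hP h h1
  refine guarded_passTo hP _ _ (fun u y hu => ?_) fun h => by rw [hw] at h; cases h
  have hne := ne_of_sign hu hv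
  have hne' := ne_of_sign hu hw
  simp [Net.addEdge, Net.removeEdge, hne, hne']

theorem guarded_replace_in {P : Position} (hP : P.Guarded) {w : P.V} {A : Formula} (B : Formula)
    (h : P.net.lab P.token w = some A) (h1 : A ≠ one) (h2 : A ≠ tensor bot bot) :
    (P.passTo ((P.net.removeEdge P.token w).addEdge w P.token B) w).Guarded := by
  have hv := sign_of_lab_to hP h h2
  have hw := sign_of_lab_from hP h h1
  refine guarded_passTo hP _ _ (fun u y hu => ?_) fun h => by rw [hw] at h; cases h
  have hne := ne_of_sign hu hv
  have hne' := ne_of_sign hu hw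
  simp [Net.addEdge, Net.removeEdge, hne, hne']

/-- If the token reaches a proponent, it arrives against the direction of an output edge of that
proponent, which must carry `⊥ ⊗ ⊥`. -/
theorem guarded_negative {P : Position} (hP : P.Guarded) {w : P.V} {A : Formula}
    (h : P.net.lab w P.token = some A) : (P.passTo P.net w).Guarded :=
  guarded_passTo hP _ _ (fun _ _ _ => ⟨rfl, rfl⟩) fun hw =>
    ⟨P.token, (lab_of_proponent hP hw h).1 ▸ h⟩

/-- The point where two proponents are needed: a `1`-move cannot end at a proponent, and it deletes
an opponent that no proponent is attached to. -/
theorem guarded_afterOne {P : Position} (hP : P.Guarded) {w : P.V} (hwv : w ≠ P.token)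
    (h : P.net.lab P.token w = some one)
    (hsole : ∀ x, P.net.graph.Adj P.token x → x = w) : (P.afterOne w hwv).Guarded := by
  have hv : P.sign P.token = Player.opponent := sign_of_lab_to hP h (by simp)
  have hw : P.sign w = Player.opponent := by
    refine sign_eq_opponent fun hw => ?_
    have hleaf := (lab_to_proponent hP hw h).2
    -- If `w` were a proponent, it and the active vertex would be each other's only neighbours,
    -- hence the whole tree. That leaves one proponent, whose edge is labelled `1`, contrary to
    -- `many`.
    have hall : ∀ u, u = P.token ∨ u = w := P.isTree.induction (v := w) (Or.inr rfl) (by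
      rintro x y hxy (rfl | rfl)
      · exact Or.inr (hsole y hxy)
      · exact Or.inl (hleaf.sole y hxy.2))
    have hprop : ∀ u, P.sign u = Player.proponent → u = w := fun u hu =>
      (hall u).resolve_left (ne_of_sign hu hv)
    rcases hP.many with ⟨u, x, hu, hx⟩ | ⟨u, u', hu, hu', hne⟩
    · obtain rfl := hprop u hu
      obtain rfl := hleaf.sole x (Or.inl (by simp [hx]))
      rw [P.isTree.lab_eq_none hx] at h
      cases h
    · exact hne ((hprop u hu).trans (hprop u' hu').symm)
  have hx : ∀ u x, P.sign u = Player.proponent → P.IsLeaf u x → x ≠ P.token := by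
    rintro u x hu hx rfl
    exact ne_of_sign hu hw (hsole u (adj_of_isLeaf hx).symm)
  refine ⟨?_, ?_, fun ht => ?_⟩
  · rintro ⟨u, hne⟩ hu
    obtain ⟨x, hux⟩ := hP.leaf u hu
    refine ⟨⟨x, hx u x hu hux⟩, hux.sign, ?_, hux.lab⟩
    rintro ⟨y, hy⟩ h
    exact Subtype.ext (hux.sole y h)
  · rcases hP.many with ⟨u, x, hu, hux⟩ | ⟨u, u', hu, hu', hne⟩
    · exact Or.inl ⟨⟨u, ne_of_sign hu hv⟩, ⟨x, hx u x hu (lab_of_proponent hP hu hux).2⟩, hu, hux⟩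
    · exact Or.inr ⟨⟨u, ne_of_sign hu hv⟩, ⟨u', ne_of_sign hu' hv⟩, hu, hu', fun h =>
        hne (congrArg Subtype.val h)⟩
  · exact absurd rfl (ne_of_sign (P := P) ht hw)

/-! ### Tensor moves -/

section Tensor

variable {P : Position} {w : P.V} {A B : Formula} {Γ Γ' Θ : Set P.V}

/-- In the target of a tensor move, the proponents other than the copies of the active vertex are
leaves. -/
theorem isLeaf_afterTensor (hP : P.Guarded) (hvw : P.net.graph.Adj P.token w)
    (hw : P.sign w = Player.opponent)
    (u : (P.afterTensor w A B Γ Γ' Θ).V)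
    (hu : (P.afterTensor w A B Γ Γ' Θ).sign u = Player.proponent)
    (hl : ∀ h, u ≠ Sum.inl ⟨P.token, h⟩) (hr : ∀ h, u ≠ Sum.inr (Sum.inl ⟨P.token, h⟩)) :
    ∃ x, (P.afterTensor w A B Γ Γ' Θ).IsLeaf u x := by
  rcases u with ⟨u, hm⟩ | ⟨u, hm⟩ | ⟨u, hm⟩
  · have hne : u ≠ P.token := by
      rintro rfl
      exact hl _ rfl
    obtain ⟨x, hx⟩ := hP.leaf u hu
    refine ⟨Sum.inl ⟨x, Net.mem_branch_of_adj hm (adj_of_isLeaf hx) hne⟩, hx.sign, ?_, ?_⟩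
    · rintro (⟨y, hy⟩ | ⟨y, hy⟩ | ⟨y, hy⟩) h
      · have := hx.sole y (by
          simpa [afterTensor, Net.addEdge, Net.disjUnion, Net.induce] using h)
        subst this
        rfl
      all_goals
        simp [afterTensor, Net.addEdge, Net.disjUnion, Net.induce, hne] at h
    · simpa [afterTensor, Net.addEdge, Net.disjUnion, Net.induce] using hx.lab
  · have hne : u ≠ P.token := by
      rintro rfl
      exact hr _ rfl
    obtain ⟨x, hx⟩ := hP.leaf u hu
    refine ⟨Sum.inr (Sum.inl ⟨x, Net.mem_branch_of_adj hm (adj_of_isLeaf hx) hne⟩), hx.sign,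
      ?_, ?_⟩
    · rintro (⟨y, hy⟩ | ⟨y, hy⟩ | ⟨y, hy⟩) h
      · simp [afterTensor, Net.addEdge, Net.disjUnion, Net.induce, hne] at h
      · have := hx.sole y (by
          simpa [afterTensor, Net.addEdge, Net.disjUnion, Net.induce] using h)
        subst this
        rfl
      · simp [afterTensor, Net.addEdge, Net.disjUnion, Net.induce, hne] at h
    · simpa [afterTensor, Net.addEdge, Net.disjUnion, Net.induce] using hx.lab
  -- On this side the new edges touch only `w`, and the cut edge could be crossed only from `w`; a
  -- proponent is not `w`.
  · have hne : u ≠ w := ne_of_sign hu hw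
    obtain ⟨x, hx⟩ := hP.leaf u hu
    have hut : u ≠ P.token := by
      rintro rfl
      exact P.isTree.notMem_side hvw hm
    refine ⟨Sum.inr (Sum.inr ⟨x, Net.mem_side_of_adj hm (adj_of_isLeaf hx) hut (Or.inr hne)⟩),
      hx.sign, ?_, ?_⟩
    · rintro (⟨y, hy⟩ | ⟨y, hy⟩ | ⟨y, hy⟩) h
      · simp [afterTensor, Net.addEdge, Net.disjUnion, Net.induce, hne] at h
      · simp [afterTensor, Net.addEdge, Net.disjUnion, Net.induce, hne] at h
      · have := hx.sole y (by
          simpa [afterTensor, Net.addEdge, Net.disjUnion, Net.induce] using h)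
        subst this
        rfl
    · simpa [afterTensor, Net.addEdge, Net.disjUnion, Net.induce] using hx.lab

/-- The edge used joins two opponents, and each proponent survives in at least one copy with its
edge intact; further copies made through `Θ` do no harm. -/
theorem guarded_afterTensor_of_opponent (hP : P.Guarded) (hv : P.sign P.token = Player.opponent)
    (h : P.net.lab P.token w = some (tensor A B))
    (hcover : Γ ∪ Γ' ∪ Θ = P.net.graph.neighborSet P.token \ {w}) :
    (P.afterTensor w A B Γ Γ' Θ).Guarded := by
  have hw : P.sign w = Player.opponent := sign_of_lab_from hP h (by simp)
  have hvw := P.isTree.adj_of_lab h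
  have hlift : ∀ u, P.sign u = Player.proponent → ∃ u' : (P.afterTensor w A B Γ Γ' Θ).V,
      (P.afterTensor w A B Γ Γ' Θ).sign u' = Player.proponent ∧
      Sum.elim Subtype.val (Sum.elim Subtype.val Subtype.val) u' = u := by
    intro u hu
    obtain ⟨n, hn, hun⟩ := P.isTree.exists_mem_side (ne_of_sign hu hv)
    by_cases hnw : n = w
    · subst hnw
      exact ⟨Sum.inr (Sum.inr ⟨u, hun⟩), hu, rfl⟩
    · have hmem : n ∈ Γ ∪ Γ' ∪ Θ := hcover ▸ ⟨hn, hnw⟩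
      rcases hmem with (hmem | hmem) | hmem
      · exact ⟨Sum.inl ⟨u, Or.inr ⟨n, Or.inl hmem, hun⟩⟩, hu, rfl⟩
      · exact ⟨Sum.inr (Sum.inl ⟨u, Or.inr ⟨n, Or.inl hmem, hun⟩⟩), hu, rfl⟩
      -- Through `Θ` there are two copies; either would do.
      · exact ⟨Sum.inl ⟨u, Or.inr ⟨n, Or.inr hmem, hun⟩⟩, hu, rfl⟩
  have hleaf : ∀ u, (P.afterTensor w A B Γ Γ' Θ).sign u = Player.proponent →
      ∃ x, (P.afterTensor w A B Γ Γ' Θ).IsLeaf u x := by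
    refine fun u hu => isLeaf_afterTensor hP hvw hw u hu ?_ ?_
    · rintro hm rfl
      exact ne_of_sign (P := P) hu hv rfl
    · rintro hm rfl
      exact ne_of_sign (P := P) hu hv rfl
  refine ⟨hleaf, ?_, fun ht => absurd rfl (ne_of_sign (P := P) ht hw)⟩
  rcases hP.many with ⟨u, x, hu, hux⟩ | ⟨u, u', hu, hu', hne⟩
  · obtain ⟨u', hu', rfl⟩ := hlift u hu
    have hx := (lab_of_proponent hP hu hux).2
    have hne : ∀ {z : P.V}, P.sign z = Player.proponent → z ≠ P.token := fun hz =>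
      ne_of_sign hz hv
    left
    rcases u' with ⟨u, hm⟩ | ⟨u, hm⟩ | ⟨u, hm⟩
    · refine ⟨_, Sum.inl ⟨x, Net.mem_branch_of_adj hm (adj_of_isLeaf hx) (hne hu)⟩, hu', ?_⟩
      simpa [afterTensor, Net.addEdge, Net.disjUnion, Net.induce] using hux
    · refine ⟨_, Sum.inr (Sum.inl ⟨x, Net.mem_branch_of_adj hm (adj_of_isLeaf hx) (hne hu)⟩),
        hu', ?_⟩
      simpa [afterTensor, Net.addEdge, Net.disjUnion, Net.induce] using hux
    · refine ⟨_, Sum.inr (Sum.inr ⟨x, Net.mem_side_of_adj hm (adj_of_isLeaf hx) (hne hu)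
        (Or.inr (ne_of_sign hu hw))⟩), hu', ?_⟩
      simpa [afterTensor, Net.addEdge, Net.disjUnion, Net.induce] using hux
  · obtain ⟨x, hx, rfl⟩ := hlift u hu
    obtain ⟨x', hx', rfl⟩ := hlift u' hu'
    exact Or.inr ⟨x, x', hx, hx', fun h => hne (by rw [h])⟩

/-- The split uses up a label `⊥ ⊗ ⊥` but creates two distinct proponents, so `many` passes to its
second alternative. -/
theorem guarded_afterTensor_of_proponent (hP : P.Guarded)
    (hv : P.sign P.token = Player.proponent)
    (h : P.net.lab P.token w = some (tensor bot bot)) :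
    (P.afterTensor w bot bot ∅ ∅ ∅).Guarded := by
  have hw : P.sign w = Player.opponent := sign_of_lab_from hP h (by simp)
  have hvw := P.isTree.adj_of_lab h
  have hloop : P.net.lab P.token P.token = none := by
    by_contra hc
    obtain ⟨C, hC⟩ := Option.ne_none_iff_exists'.1 hc
    exact P.isTree.ne_of_lab hC rfl
  have htok : ∀ y ∈ P.net.branch P.token (∅ ∪ ∅), y = P.token := by
    intro y hy
    rwa [Net.branch_empty] at hy
  have hleaf : ∀ u, (P.afterTensor w bot bot ∅ ∅ ∅).sign u = Player.proponent →
      ∃ x, (P.afterTensor w bot bot ∅ ∅ ∅).IsLeaf u x := by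
    intro u hu
    by_cases hl : ∃ h, u = Sum.inl ⟨P.token, h⟩
    · obtain ⟨hm, rfl⟩ := hl
      refine ⟨Sum.inr (Sum.inr ⟨w, P.net.mem_side_self _ _⟩), hw, ?_, Or.inr (Or.inr ?_)⟩
      · rintro (⟨y, hy⟩ | ⟨y, hy⟩ | ⟨y, hy⟩) h
        · obtain rfl := htok y hy
          simp [afterTensor, Net.addEdge, Net.disjUnion, Net.induce, hloop] at h
        · simp [afterTensor, Net.addEdge, Net.disjUnion] at h
        · simpa [afterTensor, Net.addEdge, Net.disjUnion] using h
      · simp [afterTensor, Net.addEdge, Net.disjUnion]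
    by_cases hr : ∃ h, u = Sum.inr (Sum.inl ⟨P.token, h⟩)
    · obtain ⟨hm, rfl⟩ := hr
      refine ⟨Sum.inr (Sum.inr ⟨w, P.net.mem_side_self _ _⟩), hw, ?_, Or.inr (Or.inr ?_)⟩
      · rintro (⟨y, hy⟩ | ⟨y, hy⟩ | ⟨y, hy⟩) h
        · simp [afterTensor, Net.addEdge, Net.disjUnion] at h
        · obtain rfl := htok y hy
          simp [afterTensor, Net.addEdge, Net.disjUnion, Net.induce, hloop] at h
        · simpa [afterTensor, Net.addEdge, Net.disjUnion] using h
      · simp [afterTensor, Net.addEdge, Net.disjUnion]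
    exact isLeaf_afterTensor hP hvw hw u hu (fun h h' => hl ⟨h, h'⟩) fun h h' => hr ⟨h, h'⟩
  refine ⟨hleaf, Or.inr ⟨Sum.inl ⟨P.token, P.net.root_mem_branch _ _⟩,
    Sum.inr (Sum.inl ⟨P.token, P.net.root_mem_branch _ _⟩), hv, hv, Sum.inl_ne_inr⟩,
    fun ht => absurd rfl (ne_of_sign (P := P) ht hw)⟩

/-- The result is the side of `w` with two one-vertex trees attached in succession. Empty `Γ`, `Γ'`,
`Θ` are enough, because a guarded proponent has no neighbour but `w`. -/
theorem isTree_afterTensor_empty (P : Position) (w : P.V) (A B : Formula) :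
    (P.afterTensor w A B ∅ ∅ ∅).net.IsTree := by
  refine ((P.isTree.induce_branch_empty P.token).disjUnion_addEdge
    ((P.isTree.induce_branch_empty P.token).disjUnion_addEdge (P.isTree.induce_side P.token w)
      ⟨P.token, P.net.root_mem_branch _ _⟩ ⟨w, P.net.mem_side_self _ _⟩ B)
      ⟨P.token, P.net.root_mem_branch _ _⟩
      (Sum.inr ⟨w, P.net.mem_side_self _ _⟩) A).of_isSome_iff ?_
  rintro (x | x | x) (y | y | y) <;> simp [afterTensor, Net.addEdge, Net.disjUnion]

end Tensor

theorem Is.guarded {Q : Position} {N : SignedNet} (h : Q.Is N) (hN : N.Guarded) : Q.Guarded :=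
  SignedNet.Iso.guarded h hN.normalise

/-- Every tree is normalised by some position. -/
theorem exists_is {N : SignedNet} (h : N.net.IsTree) : ∃ Q : Position, Q.Is N :=
  ⟨⟨N.normalise, h.normalise, N.net.normalise_isNormal⟩, Equiv.refl _, fun _ _ => rfl,
    fun _ => rfl, rfl⟩

theorem guarded_of_move {P Q : Position} (hP : P.Guarded) (h : Move P Q) : Q.Guarded := by
  cases h with
  | negative w A h hQ => exact hQ.guarded (guarded_negative hP h)
  | one w h hsole hQ => exact hQ.guarded (guarded_afterOne hP _ h hsole)
  | tensor w A B Γ Γ' Θ h hcover _ _ _ _ hQ =>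
    refine hQ.guarded ?_
    cases hv : P.sign P.token with
    | opponent => exact guarded_afterTensor_of_opponent hP hv h hcover
    | proponent =>
      obtain ⟨hAB, hleaf⟩ := lab_of_proponent hP hv h
      -- A proponent is a leaf, so it has no other neighbours to distribute.
      have hempty : Γ ∪ Γ' ∪ Θ = ∅ := by
        rw [hcover, Set.sdiff_eq_empty]
        exact fun y hy => hleaf.sole y hy.2
      simp only [Set.union_empty_iff] at hempty
      obtain ⟨⟨rfl, rfl⟩, rfl⟩ := hempty
      cases hAB
      exact guarded_afterTensor_of_proponent hP hv h
  | plusLeft w A B h hQ => exact hQ.guarded (guarded_replace_out hP A h (by simp) (by simp))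
  | plusRight w A B h hQ => exact hQ.guarded (guarded_replace_out hP B h (by simp) (by simp))
  | whyNot w A n h hQ => exact hQ.guarded (guarded_replace_in hP _ h (by simp) (by simp))

theorem exists_move {P : Position} (hP : P.Guarded) (hv : P.active = Player.proponent) :
    ∃ Q, Move P Q := by
  obtain ⟨w, h⟩ := hP.active hv
  obtain ⟨Q, hQ⟩ := exists_is (isTree_afterTensor_empty P w bot bot)
  refine ⟨Q, Move.tensor w bot bot ∅ ∅ ∅ h ?_ (by simp) (by simp) (by simp) (by simp) hQ⟩
  have hleaf := (lab_of_proponent hP hv h).2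
  rw [Set.union_self, Set.union_self, eq_comm, Set.sdiff_eq_empty]
  exact fun y hy => hleaf.sole y hy.2

end Position

/-! ### Plays and the strategy of all plays -/

theorem lastPosition_cons (U P : Position) (l : List Position) :
    lastPosition U (P :: l) = lastPosition P l :=
  List.getLastD_cons

theorem IsPlay.guarded {U : Position} (hU : U.Guarded) {l : List Position} (h : IsPlay U l) :
    (lastPosition U l).Guarded := by
  induction l generalizing U with
  | nil => exact hU
  | cons P l ih =>
    rw [lastPosition_cons]
    have h' := List.isChain_cons_cons.1 h
    exact ih (Position.guarded_of_move hU h'.1) h'.2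

theorem IsPlay.append_singleton {U : Position} {l : List Position} (h : IsPlay U l) {Q : Position}
    (hQ : Move (lastPosition U l) Q) : IsPlay U (l ++ [Q]) := by
  induction l generalizing U with
  | nil => exact List.isChain_cons_cons.2 ⟨hQ, List.isChain_singleton _⟩
  | cons P l ih =>
    rw [lastPosition_cons] at hQ
    have h' := List.isChain_cons_cons.1 h
    exact List.isChain_cons_cons.2 ⟨h'.1, ih h'.2 hQ⟩

/-- On a guarded position, the strategy that consists of all plays is winning. -/
theorem isWinning_of_guarded {U : Position} (hU : U.Guarded) : IsWinning U {l | IsPlay U l} := by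
  refine ⟨⟨fun l hl => hl, List.isChain_singleton _, fun l hl l' hl' => ?_,
    fun l hl _ Q hQ => IsPlay.append_singleton hl hQ, fun _ _ l' hl' _ => hl'⟩, ?_⟩
  · exact List.IsChain.prefix hl ((List.prefix_cons_inj U).2 hl')
  · rintro l ⟨hl, hmax⟩
    refine Position.sign_eq_opponent fun hp => ?_
    -- A proponent holding the token could still move, and the longer play would again belong to the
    -- set, against maximality.
    obtain ⟨Q, hQ⟩ := Position.exists_move (IsPlay.guarded hU hl) hp
    have := hmax _ (IsPlay.append_singleton hl hQ) (List.prefix_append _ _)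
    simp at this

/-! ### The initial position and the conclusion -/

/-- The tree with one vertex. -/
def RootedTree.single : RootedTree where
  V := Unit
  net := ⟨fun _ _ => none⟩
  root := ()
  isTree := Net.isTree_of_unique fun _ _ => rfl
  isNormal := fun _ _ _ h => by cases h

theorem guarded_initialPosition (T' : RootedTree) (t : RootedTree.single.V ⊕ T'.V) :
    (initialPosition RootedTree.single T' (tensor bot bot) t).Guarded := by
  have hlab : (joinNet RootedTree.single T' (tensor bot bot)).lab (Sum.inl ())
      (Sum.inr T'.root) = some (tensor bot bot) := by
    simp [joinNet, Net.addEdge, RootedTree.single]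
  -- The invariant is checked before normalisation, where the edges are explicit, and then
  -- transported by `Guarded.normalise`.
  have h : SignedNet.Guarded ⟨_, joinNet RootedTree.single T' (tensor bot bot),
      Sum.elim (fun _ => Player.proponent) (fun _ => Player.opponent), t⟩ := by
    refine ⟨?_, Or.inl ⟨Sum.inl (), Sum.inr T'.root, rfl, hlab⟩, ?_⟩
    · rintro (u | u) hu
      · refine ⟨Sum.inr T'.root, rfl, ?_, Or.inl hlab⟩
        rintro (y | y) hy
        · simp [joinNet, Net.addEdge, Net.disjUnion, RootedTree.single] at hy
        · by_contra hne
          rcases hy with hy | hy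
          · simp only [joinNet, Net.addEdge, Net.disjUnion] at hy
            rw [if_neg fun h => hne h.2] at hy
            cases hy
          · simp [joinNet, Net.addEdge, Net.disjUnion] at hy
      · cases hu
    · rcases t with t | t
      · exact fun _ => ⟨_, hlab⟩
      · intro hu
        cases hu
  exact h.normalise

theorem gLLTNValid_bot_tensor_bot : GLLTNValid (tensor bot bot) :=
  ⟨RootedTree.single, fun T' t => ⟨_, isWinning_of_guarded (guarded_initialPosition T' t)⟩⟩

end LinLogic

theorem mainTheorem10 :
    (¬ ∀ A : LinLogic.Formula, LinLogic.GLLTNValid A → LinLogic.LLProvable [A]) ∧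
    (¬ ∀ A : LinLogic.Formula, LinLogic.GLLTNValid A → LinLogic.LLTNProvable [A]) ∧
    LinLogic.GLLTNValid (LinLogic.Formula.tensor LinLogic.Formula.bot LinLogic.Formula.bot) ∧
    ¬ LinLogic.LLProvable [LinLogic.Formula.tensor LinLogic.Formula.bot LinLogic.Formula.bot] ∧
    ¬ LinLogic.LLTNProvable
        [LinLogic.Formula.tensor LinLogic.Formula.bot LinLogic.Formula.bot] := by
  have h := LinLogic.not_truth_bot_tensor_bot
  exact ⟨fun H => h (H _ LinLogic.gLLTNValid_bot_tensor_bot).truth,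
    fun H => h (H _ LinLogic.gLLTNValid_bot_tensor_bot).truth,
    LinLogic.gLLTNValid_bot_tensor_bot, fun H => h H.truth, fun H => h H.truth⟩
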